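/- Let $A$ be a unital $C^*$-algebra and let $E$ be a right Hilbert $A$-module that is finitely generated as a right $A$-module. Let $\mathcal S A = C_0(\mathbb R)\otimes A = C_0(\mathbb R, A)$ be the suspension of $A$, and let $\mathcal S E = C_0(\mathbb R)\otimes E = C_0(\mathbb R,E)$, a right Hilbert $\mathcal S A$-module with pointwise action and inner product. For a right Hilbert $B$-module $F$ write $\operatorname{End}_B(F)$ for the $C^*$-algebra of adjointable operators on $F$, $\operatorname{Mult}(B)$ for the multiplier algebra of $B$, and $\operatorname{Mult}(F)=\operatorname{Hom}_B(B,F)$ for the multiplier module (the adjointable operators $B\to F$), which is a right inner product $\operatorname{Mult}(B)$-module under $(m\mid m')=m^*m'$ and carries the left inner product ${}_{\operatorname{End}_B(F)}(m\mid m')=\Theta_{m,m'}=m m'^*$. If $B\hookrightarrow C$ embeds $B$ as an essential ideal of a unital $C^*$-algebra $C$, then $F$ is called $C$-finite projective if $F\cong pB^n$ as right Hilbert $B$-modules for some $n\in\mathbb N$ and some projection $p\in M_n(C)$. Then: 1. $\operatorname{Mult}(\mathcal S E)$ is full as a left Hilbert $\operatorname{End}_{\mathcal S A}(\mathcal S E)$-module: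 the closed linear span of the operators $\Theta_{m,m'}$, $m,m'\in\operatorname{Mult}(\mathcal S E)$, is all of $\operatorname{End}_{\mathcal S A}(\mathcal S E)$. 2. $\mathcal S E$ is $C(\beta\mathbb R)\otimes A$-finite projective, where $C(\beta\mathbb R)\otimes A=C(\beta\mathbb R,A)$ and $\beta\mathbb R$ is the Stone–Čech compactification of $\mathbb R$. 3. In fact the projection can be chosen with constant entries: there are $n\in\mathbb N$ and a projection $q\in M_n(A)$ such that $\mathcal S E\cong(1\otimes q)(\mathcal S A)^n$ as right Hilbert $\mathcal S A$-modules and $\operatorname{Mult}(\mathcal S E)\cong(1\otimes q)\operatorname{Mult}(\mathcal S A)^n$ as right inner product $\operatorname{Mult}(\mathcal S A)$-modules, where $1\otimes q$ is the constant function with value $q$. In particular $\mathcal S E$ is also finite projective over the smaller unitisation $C(\mathbb R\cup\{\infty\})\otimes A$ of $\mathcal S A$. -/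

import Mathlib

open scoped ZeroAtInfty MultiplierAlgebra

noncomputable section

namespace HilbertSuspension

open MulOpposite

/-! ### Right Hilbert modules

A right Hilbert module over a C⋆-algebra `B` is a complete `CStarModule` over the opposite algebra
`Bᵐᵒᵖ`: the right action is `x · b = op b • x`, and the `B`-valued inner product `rinner B x y` is
conjugate linear in `x` and linear in `y`. -/

section General

variable (B : Type*) [NonUnitalCStarAlgebra B] [PartialOrder B]
variable {E F G : Type*}
variable [NormedAddCommGroup E] [NormedSpace ℂ E] [SMul Bᵐᵒᵖ E] [CStarModule Bᵐᵒᵖ E]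
variable [NormedAddCommGroup F] [NormedSpace ℂ F] [SMul Bᵐᵒᵖ F] [CStarModule Bᵐᵒᵖ F]
variable [NormedAddCommGroup G] [NormedSpace ℂ G] [SMul Bᵐᵒᵖ G] [CStarModule Bᵐᵒᵖ G]

/-- The `B`-valued inner product `(x | y)` of a right Hilbert `B`-module. -/
def rinner (x y : E) : B := unop (inner Bᵐᵒᵖ x y)

theorem star_rinner (x y : E) : star (rinner B x y) = rinner B y x := by
  rw [rinner, rinner, ← CStarModule.star_inner x y, unop_star]

theorem rinner_add_right (x y z : E) : rinner B x (y + z) = rinner B x y + rinner B x z := by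
  simp [rinner]

theorem rinner_add_left (x y z : E) : rinner B (x + y) z = rinner B x z + rinner B y z := by
  simp [rinner]

theorem rinner_smul_right (c : ℂ) (x y : E) : rinner B x (c • y) = c • rinner B x y := by
  simp [rinner]

theorem rinner_smul_left (c : ℂ) (x y : E) : rinner B (c • x) y = star c • rinner B x y := by
  simp [rinner]

/-- `(x | y · b) = (x | y) b`. -/
theorem rinner_op_smul_right (b : B) (x y : E) : rinner B x (op b • y) = rinner B x y * b := by
  simp [rinner]

/-- A C⋆-algebra `B` as a right Hilbert module over itself, `(x | y) = x⋆ y`. -/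
instance selfRight [StarOrderedRing B] : CStarModule Bᵐᵒᵖ B where
  inner x y := op (star x * y)
  inner_add_right := by simp [mul_add]
  inner_self_nonneg {x} := star_mul_self_nonneg x
  inner_self := by simp
  inner_op_smul_right {a x y} := by
    apply unop_injective
    simp [mul_assoc]
  inner_smul_right_complex := by
    intro z x y
    apply unop_injective
    simp [mul_smul_comm]
  star_inner x y := by
    apply unop_injective
    simp
  norm_eq_sqrt_norm_inner_self x := by
    rw [MulOpposite.norm_op, CStarRing.norm_star_mul_self, Real.sqrt_mul_self (norm_nonneg _)]

theorem rinner_self_right [StarOrderedRing B] (x y : B) : rinner B x y = star x * y := rfl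

variable (E F) in
/-- The space `Hom_B(E, F)` of adjointable operators, with the operator norm. (An adjointable map
is automatically linear and bounded, and so is its adjoint.) -/
def Adjointable : Submodule ℂ (E →L[ℂ] F) where
  carrier := {T | ∃ S : F →L[ℂ] E, ∀ x y, rinner B (T x) y = rinner B x (S y)}
  add_mem' := by
    rintro T T' ⟨S, hS⟩ ⟨S', hS'⟩
    exact ⟨S + S', fun x y => by
      simp [rinner_add_left, rinner_add_right, hS, hS']⟩
  zero_mem' := ⟨0, fun x y => by
    have h1 := rinner_smul_left B 0 (0 : F) y
    have h2 := rinner_smul_right B 0 x (0 : E)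
    simp only [zero_smul, star_zero] at h1 h2
    simp [h1, h2]⟩
  smul_mem' := by
    rintro c T ⟨S, hS⟩
    exact ⟨star c • S, fun x y => by simp [rinner_smul_left, rinner_smul_right, hS]⟩

variable {B}

namespace Adjointable

/-- The adjoint `T⋆`, determined by `(T x | y) = (x | T⋆ y)`. -/
def adj (T : Adjointable B E F) : Adjointable B F E :=
  ⟨T.2.choose, T.1, fun x y => by
    rw [← star_rinner B y, ← T.2.choose_spec, star_rinner]⟩

theorem rinner_adj (T : Adjointable B E F) (x : E) (y : F) :
    rinner B (T.1 x) y = rinner B x ((adj T).1 y) := T.2.choose_spec x y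

/-- Composition of adjointable operators. -/
def comp (T : Adjointable B F G) (S : Adjointable B E F) : Adjointable B E G :=
  ⟨T.1.comp S.1, (adj S).1.comp (adj T).1, fun x y => by
    simp [← rinner_adj]⟩

end Adjointable

/-! ### The multiplier module -/

section Multiplier

variable [StarOrderedRing B]

variable (B E) in
/-- The multiplier module `Mult(E) = Hom_B(B, E)` of a right Hilbert `B`-module `E`. It is the
corner of the multiplier algebra of the linking algebra of `E` that consists of the operators
from `B` to `E`. -/
abbrev MultModule := Adjointable B B E

namespace MultModule

/-- The right action of the multiplier algebra `Mult(B)` on `Mult(E)`, `(m · d) b = m (d b)`. -/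
def act (m : MultModule B E) (d : 𝓜(ℂ, B)) : MultModule B E :=
  ⟨m.1.comp d.fst, (star d).fst.comp (Adjointable.adj m).1, fun x y => by
    rw [ContinuousLinearMap.comp_apply, ContinuousLinearMap.comp_apply, Adjointable.rinner_adj,
      rinner_self_right, rinner_self_right, DoubleCentralizer.star_fst]
    have h := d.central (star ((Adjointable.adj m).1 y)) x
    have h' := congrArg star h
    simpa using h'.symm⟩

/-- The inner product `(m | m') = m⋆ m'` of `Mult(E)`, with values in the multiplier algebra
`Mult(B)`: left multiplication by it is `b ↦ m⋆ (m' b)`. -/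
def inner (m m' : MultModule B E) : 𝓜(ℂ, B) where
  fst := (Adjointable.adj m).1.comp m'.1
  snd := (starL ℂ (A := B)).toContinuousLinearMap.comp
    (((Adjointable.adj m').1.comp m.1).comp (starL ℂ (A := B)).toContinuousLinearMap)
  central x y := by
    have h1 := Adjointable.rinner_adj m (star x) (m'.1 y)
    have h2 := Adjointable.rinner_adj m' y (m.1 (star x))
    have h3 := congrArg star h2
    rw [star_rinner, star_rinner, h1] at h3
    simpa [rinner_self_right] using h3.symm

/-- The rank-one operator `Θ_{m, m'} = m m'⋆`, `g ↦ m · (m' | g)`, as an adjointable operator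
on `E`. This is the left inner product of `Mult(E)` with values in `End_B(E)`. -/
def theta (m m' : MultModule B E) : Adjointable B E E := Adjointable.comp m (Adjointable.adj m')

variable (B E) in
/-- `Mult(E)` is full as a left Hilbert module over `End_B(E)`: the closed linear span of the
left inner products is all of `End_B(E)`. -/
def IsFullLeft : Prop :=
  (Submodule.span ℂ (Set.range fun m : MultModule B E × MultModule B E =>
    theta m.1 m.2)).topologicalClosure = (⊤ : Submodule ℂ (Adjointable B E E))

end MultModule

end Multiplier

end General

/-! ### Unitisations and finite projectivity -/

section FiniteProjective

/-- A unitisation of `B`: an embedding of `B` as an essential ideal of a unital C⋆-algebra `C`. -/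
structure Unitisation (B C : Type*) [NonUnitalCStarAlgebra B] [CStarAlgebra C] where
  /-- the embedding -/
  hom : B →⋆ₙₐ[ℂ] C
  injective : Function.Injective hom
  mul_left_mem : ∀ (c : C) (b : B), ∃ b' : B, hom b' = c * hom b
  mul_right_mem : ∀ (c : C) (b : B), ∃ b' : B, hom b' = hom b * c
  essential : ∀ c : C, (∀ b : B, c * hom b = 0) → c = 0

/-- Let `M` be a complex vector space with a right action `act` of a ⋆-algebra `D` and a `D`-valued
inner product `inn`, let `ι` embed `D` in the algebra `C`, and let `p` be an `n × n` matrix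
over `C`. The proposition says that `M` is isomorphic, as a right inner product `D`-module, to
`p Dⁿ = {v ∈ Dⁿ | p v = v}` (for a projection `p`), where `Dⁿ` has the
inner product `(v | w) = ∑ i, vᵢ⋆ wᵢ`. -/
def IsoCorner {M D C : Type*} [AddCommGroup M] [Module ℂ M]
    [NonUnitalRing D] [Module ℂ D] [Star D] [NonUnitalRing C]
    (act : M → D → M) (inn : M → M → D) (ι : D → C) {n : ℕ} (p : Matrix (Fin n) (Fin n) C) :
    Prop :=
  ∃ U : M →ₗ[ℂ] (Fin n → D),
    Function.Injective U ∧
    (∀ x d i, U (act x d) i = U x i * d) ∧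
    (∀ x y, inn x y = ∑ i, star (U x i) * U y i) ∧
    ∀ v : Fin n → D, (∃ x, U x = v) ↔ ∀ i, ∑ j, p i j * ι (v j) = ι (v i)

/-- `E ≅ p Bⁿ` as right Hilbert `B`-modules, for a matrix `p` over a unitisation of `B`. -/
def HilbertIsoCorner {B C : Type*} [NonUnitalCStarAlgebra B] [PartialOrder B] [CStarAlgebra C]
    (u : Unitisation B C) (E : Type*) [NormedAddCommGroup E] [NormedSpace ℂ E] [SMul Bᵐᵒᵖ E]
    [CStarModule Bᵐᵒᵖ E] {n : ℕ} (p : Matrix (Fin n) (Fin n) C) : Prop :=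
  IsoCorner (M := E) (fun x b => op b • x) (rinner B) u.hom p

/-- The right Hilbert `B`-module `E` is `C`-finite projective, for a unitisation `C` of `B`:
it is isomorphic to `p Bⁿ` for some `n` and some projection `p ∈ Mₙ(C)`. -/
def IsFiniteProjective {B C : Type*} [NonUnitalCStarAlgebra B] [PartialOrder B] [CStarAlgebra C]
    (u : Unitisation B C) (E : Type*) [NormedAddCommGroup E] [NormedSpace ℂ E] [SMul Bᵐᵒᵖ E]
    [CStarModule Bᵐᵒᵖ E] : Prop :=
  ∃ (n : ℕ) (p : Matrix (Fin n) (Fin n) C), IsStarProjection p ∧ HilbertIsoCorner u E p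

end FiniteProjective

/-! ### Suspensions

The suspension `C₀(ℝ) ⊗ A` of `A` is the C⋆-algebra `C₀(ℝ, A)`, and the suspension `C₀(ℝ) ⊗ E` of
a Hilbert `A`-module `E` is the Hilbert `C₀(ℝ, A)`-module `C₀(ℝ, E)` with pointwise operations. -/

section Suspension

variable {A : Type*} [CStarAlgebra A]

/-- The order of the C⋆-algebra `C₀(ℝ, A)`. -/
instance : PartialOrder C₀(ℝ, A) := CStarAlgebra.spectralOrder _

instance : StarOrderedRing C₀(ℝ, A) := CStarAlgebra.spectralOrderedRing _

/-- Evaluation at a point, as a ⋆-homomorphism. -/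
def evalHom (t : ℝ) : C₀(ℝ, A) →⋆ₙₐ[ℂ] A where
  toFun f := f t
  map_smul' _ _ := rfl
  map_zero' := rfl
  map_add' _ _ := rfl
  map_mul' _ _ := rfl
  map_star' _ := rfl

variable [PartialOrder A] [StarOrderedRing A]

theorem zeroAtInfty_nonneg {f : C₀(ℝ, A)} (hf : ∀ t, 0 ≤ f t) : 0 ≤ f := by
  have hsa : IsSelfAdjoint f := by
    ext t
    exact (IsSelfAdjoint.of_nonneg (hf t)).star_eq
  rw [← CFC.negPart_eq_zero_iff f hsa]
  ext t
  have hc : Continuous (evalHom (A := A) t) :=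
    (ContinuousEvalConst.continuous_eval_const t).comp ZeroAtInftyContinuousMap.isometry_toBCF.continuous
  have h := NonUnitalStarAlgHom.map_cfcₙ (evalHom (A := A) t) (fun r : ℝ => r⁻) f (hφ := hc)
    (hφa := IsSelfAdjoint.of_nonneg (hf t))
  exact h.trans ((CFC.negPart_eq_zero_iff (f t) (IsSelfAdjoint.of_nonneg (hf t))).2 (hf t))

theorem zeroAtInfty_norm_le {E : Type*} [NormedAddCommGroup E] (f : C₀(ℝ, E)) {C : ℝ}
    (hC : 0 ≤ C) : ‖f‖ ≤ C ↔ ∀ t, ‖f t‖ ≤ C :=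
  BoundedContinuousFunction.norm_le (f := f.toBCF) hC

variable {E : Type*} [NormedAddCommGroup E] [NormedSpace ℂ E] [Module Aᵐᵒᵖ E] [CStarModule Aᵐᵒᵖ E]

theorem norm_op_smul_le (a : Aᵐᵒᵖ) (x : E) : ‖a • x‖ ≤ ‖x‖ * ‖a‖ := by
  have h := CStarModule.norm_sq_eq Aᵐᵒᵖ (x := a • x)
  rw [CStarModule.inner_op_smul_right, CStarModule.inner_op_smul_left] at h
  have h2 : ‖a • x‖ ^ 2 ≤ (‖x‖ * ‖a‖) ^ 2 := by
    rw [h]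
    calc _ ≤ ‖a‖ * (‖inner Aᵐᵒᵖ x x‖ * ‖star a‖) :=
          (norm_mul_le _ _).trans (by gcongr; exact norm_mul_le _ _)
      _ = _ := by rw [norm_star, ← CStarModule.norm_sq_eq]; ring
  exact le_of_sq_le_sq h2 (by positivity)

theorem continuous_op_smul : Continuous fun q : Aᵐᵒᵖ × E => q.1 • q.2 := by
  have : IsBoundedSMul Aᵐᵒᵖ E := .of_norm_smul_le fun a x =>
    (norm_op_smul_le a x).trans_eq (mul_comm _ _)
  exact continuous_smul

theorem continuous_rinner : Continuous fun q : E × E => rinner A q.1 q.2 :=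
  continuous_unop.comp CStarModule.continuous_inner

variable (E) in
/-- The suspension `C₀(ℝ) ⊗ E = C₀(ℝ, E)` of a Hilbert module `E`, with the supremum norm. -/
def Suspension : Type _ := C₀(ℝ, E)

namespace Suspension

instance : NormedAddCommGroup (Suspension E) := inferInstanceAs (NormedAddCommGroup C₀(ℝ, E))

instance : NormedSpace ℂ (Suspension E) := inferInstanceAs (NormedSpace ℂ C₀(ℝ, E))

instance : FunLike (Suspension E) ℝ E := inferInstanceAs (FunLike C₀(ℝ, E) ℝ E)

theorem ext {x y : Suspension E} (h : ∀ t, x t = y t) : x = y := DFunLike.ext _ _ h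

/-- The right action of `C₀(ℝ, A)` on `C₀(ℝ, E)`, `(x · f) t = x t · f t`. -/
instance : SMul C₀(ℝ, A)ᵐᵒᵖ (Suspension E) where
  smul f x :=
    ({ toFun := fun t => op (unop f t) • x t
       continuous_toFun := continuous_op_smul.comp
         ((continuous_op.comp (map_continuous (unop f))).prodMk (map_continuous (F := C₀(ℝ, E)) x))
       zero_at_infty' := by
         have h1 := (unop f).zero_at_infty'
         have h2 := ZeroAtInftyContinuousMap.zero_at_infty' (α := ℝ) (β := E) x
         have h := (continuous_op_smul.tendsto (op (0 : A), (0 : E))).comp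
           (((continuous_op.tendsto _).comp h1).prodMk_nhds h2)
         rwa [smul_zero] at h } : C₀(ℝ, E))

theorem op_smul_apply (f : C₀(ℝ, A)) (x : Suspension E) (t : ℝ) :
    (op f • x) t = op (f t) • x t := rfl

/-- The inner product `(x | y) t = (x t | y t)` of `C₀(ℝ, E)`. -/
def inn (x y : Suspension E) : C₀(ℝ, A) where
  toFun t := rinner A (x t) (y t)
  continuous_toFun := (continuous_rinner (A := A) (E := E)).comp
    ((map_continuous (F := C₀(ℝ, E)) x).prodMk (map_continuous (F := C₀(ℝ, E)) y))
  zero_at_infty' := by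
    have h1 := ZeroAtInftyContinuousMap.zero_at_infty' (α := ℝ) (β := E) x
    have h2 := ZeroAtInftyContinuousMap.zero_at_infty' (α := ℝ) (β := E) y
    have h := ((continuous_rinner (A := A)).tendsto ((0 : E), (0 : E))).comp (h1.prodMk_nhds h2)
    have h0 : rinner A (0 : E) (0 : E) = 0 := by simp [rinner]
    rwa [h0] at h

instance : CStarModule C₀(ℝ, A)ᵐᵒᵖ (Suspension E) where
  inner x y := op (inn x y)
  inner_add_right {x y z} := by
    apply unop_injective
    ext t
    exact rinner_add_right A _ _ _
  inner_self_nonneg {x} := zeroAtInfty_nonneg fun t =>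
    CStarModule.inner_self_nonneg (A := Aᵐᵒᵖ) (x := x t)
  inner_self {x} := by
    refine ⟨fun h => Suspension.ext fun t => ?_, fun h => ?_⟩
    · have h' := congrArg (fun g : C₀(ℝ, A) => op (g t)) (op_injective (h.trans op_zero.symm))
      exact CStarModule.inner_self.1 h'
    · subst h
      apply unop_injective
      ext t
      exact congrArg unop (CStarModule.inner_self (A := Aᵐᵒᵖ) (x := (0 : E)).2 rfl)
  inner_op_smul_right {f x y} := by
    apply unop_injective
    ext t
    exact rinner_op_smul_right A _ _ _
  inner_smul_right_complex {z x y} := by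
    apply unop_injective
    ext t
    exact rinner_smul_right A _ _ _
  star_inner x y := by
    apply unop_injective
    ext t
    exact star_rinner A _ _
  norm_eq_sqrt_norm_inner_self x := by
    have key : ∀ t, ‖x t‖ ^ 2 = ‖(inn x x : C₀(ℝ, A)) t‖ := fun t =>
      CStarModule.norm_sq_eq Aᵐᵒᵖ (x := x t)
    refine le_antisymm ?_ ?_
    · refine (zeroAtInfty_norm_le (E := E) x (Real.sqrt_nonneg _)).2 fun t => ?_
      refine Real.le_sqrt_of_sq_le ?_
      refine (key t).le.trans ?_
      rw [norm_op]
      exact (zeroAtInfty_norm_le _ (norm_nonneg _)).1 le_rfl t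
    · refine (Real.sqrt_le_left (norm_nonneg x)).2 ?_
      refine (zeroAtInfty_norm_le _ (by positivity)).2 fun t => ?_
      refine (key t).symm.le.trans ?_
      gcongr
      exact (zeroAtInfty_norm_le (E := E) x (norm_nonneg _)).1 le_rfl t

theorem rinner_apply (x y : Suspension E) (t : ℝ) :
    rinner C₀(ℝ, A) x y t = rinner A (x t) (y t) := rfl

end Suspension

end Suspension

/-! ### Unitisations of the suspension -/

section Compactification

variable {A : Type*} [CStarAlgebra A]

/-- The continuous extension of `f ∈ C₀(ℝ, A)` to `ℝ ∪ {∞}`, with value `0` at `∞`. -/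
def extendOnePoint (f : C₀(ℝ, A)) : C(OnePoint ℝ, A) :=
  OnePoint.continuousMapMk (f : C(ℝ, A)) 0 (by
    rw [Filter.coclosedCompact_eq_cocompact]
    exact f.zero_at_infty')

theorem extendOnePoint_coe (f : C₀(ℝ, A)) (t : ℝ) : extendOnePoint f (t : OnePoint ℝ) = f t := rfl

variable (A) in
/-- For a compactification `K` of `ℝ` with dense inclusion `j : ℝ → K` and collapse map
`π : K → ℝ ∪ {∞}`, the algebra `C(K) ⊗ A = C(K, A)` is a unitisation of `C₀(ℝ, A)`: extend
functions by zero. -/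
def compactificationUnitisation {K : Type*} [TopologicalSpace K] [CompactSpace K] (j : C(ℝ, K))
    (hj : DenseRange j) (π : C(K, OnePoint ℝ)) (hπ : ∀ t : ℝ, π (j t) = (t : OnePoint ℝ)) :
    Unitisation C₀(ℝ, A) C(K, A) :=
  have key : ∀ {g h : C(K, A)}, (∀ t, g (j t) = h (j t)) → g = h := fun {g h} H =>
    DFunLike.coe_injective (hj.equalizer g.continuous h.continuous (funext H))
  have ev : ∀ (f : C₀(ℝ, A)) (t : ℝ), ((extendOnePoint f).comp π) (j t) = f t := fun f t => by
    rw [ContinuousMap.comp_apply, hπ, extendOnePoint_coe]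
  { hom :=
      { toFun := fun f => (extendOnePoint f).comp π
        map_smul' := fun c f => key fun t => by
          simp only [ev, MonoidHom.id_apply, ContinuousMap.smul_apply]
          rfl
        map_zero' := key fun t => by
          rw [ev]
          rfl
        map_add' := fun f g => key fun t => by
          rw [ev, ContinuousMap.add_apply, ev, ev]
          rfl
        map_mul' := fun f g => key fun t => by
          rw [ev, ContinuousMap.mul_apply, ev, ev]
          rfl
        map_star' := fun f => key fun t => by
          rw [ev, ContinuousMap.star_apply, ev]
          rfl }
    injective := fun f g h => by
      ext t
      rw [← ev f t, ← ev g t]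
      exact congrArg (fun u : C(K, A) => u (j t)) h
    mul_left_mem := fun c f =>
      ⟨{ toFun := fun t => c (j t) * f t
         continuous_toFun := by fun_prop
         zero_at_infty' := squeeze_zero_norm
           (fun t => (norm_mul_le _ _).trans
             (mul_le_mul_of_nonneg_right (c.norm_coe_le_norm _) (norm_nonneg _)))
           (by simpa using (f.zero_at_infty'.norm.const_mul ‖c‖)) }, key fun t => by
        exact (ev _ t).trans (congrArg (c (j t) * ·) (ev f t).symm)⟩
    mul_right_mem := fun c f =>
      ⟨{ toFun := fun t => f t * c (j t)
         continuous_toFun := by fun_prop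
         zero_at_infty' := squeeze_zero_norm
           (fun t => (norm_mul_le _ _).trans
             (mul_le_mul_of_nonneg_left (c.norm_coe_le_norm _) (norm_nonneg _)))
           (by simpa using (f.zero_at_infty'.norm.mul_const ‖c‖)) }, key fun t => by
        exact (ev _ t).trans (congrArg (· * c (j t)) (ev f t).symm)⟩
    essential := fun c hc => key fun t => by
      obtain ⟨g, hg1, -, hgc, -⟩ := exists_continuous_one_zero_of_isCompact
        (isCompact_singleton (x := t)) isClosed_empty (by simp)
      let b : C₀(ℝ, A) :=
        { toFun := fun s => (g s : ℂ) • (1 : A)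
          continuous_toFun := by fun_prop
          zero_at_infty' := by
            refine squeeze_zero_norm (a := fun s => ‖g s‖ * ‖(1 : A)‖) (fun s => ?_) ?_
            · simp [norm_smul]
            · simpa using (hgc.is_zero_at_infty.norm.mul_const ‖(1 : A)‖) }
      have h := congrArg (fun u : C(K, A) => u (j t)) (hc b)
      have hb : b t = 1 := by
        change (g t : ℂ) • (1 : A) = 1
        simp [hg1 (Set.mem_singleton t)]
      have h' : c (j t) * b t = 0 := (congrArg (c (j t) * ·) (ev b t).symm).trans h
      simpa [hb] using h' }

variable (A) in
/-- The unitisation `C(βℝ) ⊗ A = C(βℝ, A)` of `C₀(ℝ, A)`. -/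
def betaUnitisation : Unitisation C₀(ℝ, A) C(StoneCech ℝ, A) :=
  compactificationUnitisation A ⟨stoneCechUnit, continuous_stoneCechUnit⟩ denseRange_stoneCechUnit
    ⟨stoneCechExtend (OnePoint.continuous_coe (X := ℝ)), continuous_stoneCechExtend _⟩
    (fun t => stoneCechExtend_stoneCechUnit OnePoint.continuous_coe t)

variable (A) in
/-- The unitisation `C(ℝ ∪ {∞}) ⊗ A = C(ℝ ∪ {∞}, A)` of `C₀(ℝ, A)`. -/
def onePointUnitisation : Unitisation C₀(ℝ, A) C(OnePoint ℝ, A) :=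
  compactificationUnitisation A ⟨(↑), OnePoint.continuous_coe⟩ OnePoint.denseRange_coe
    (ContinuousMap.id _) (fun _ => rfl)

/-- The embedding of `A` in the multiplier algebra of `C₀(ℝ, A)` as constant functions: `a` acts by
pointwise multiplication from the left and from the right. -/
def constMult (a : A) : 𝓜(ℂ, C₀(ℝ, A)) where
  fst := LinearMap.mkContinuous
    { toFun := fun f : C₀(ℝ, A) => a • f
      map_add' := fun f g => by ext t; exact mul_add _ _ _
      map_smul' := fun c f => by ext t; exact mul_smul_comm _ _ _ } ‖a‖ (fun f => by
        refine (zeroAtInfty_norm_le _ (by positivity)).2 fun t => ?_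
        refine (norm_mul_le _ _).trans ?_
        gcongr
        exact f.toBCF.norm_coe_le_norm t)
  snd := LinearMap.mkContinuous
    { toFun := fun f : C₀(ℝ, A) => op a • f
      map_add' := fun f g => by ext t; exact add_mul _ _ _
      map_smul' := fun c f => by ext t; exact smul_mul_assoc _ _ _ } ‖a‖ (fun f => by
        refine (zeroAtInfty_norm_le _ (by positivity)).2 fun t => ?_
        refine (norm_mul_le (f t) a).trans ?_
        rw [mul_comm]
        gcongr
        exact f.toBCF.norm_coe_le_norm t)
  central f g := by
    ext t
    exact mul_assoc _ _ _

theorem constMult_fst_apply (a : A) (f : C₀(ℝ, A)) (t : ℝ) : (constMult a).fst f t = a * f t := rfl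

theorem constMult_snd_apply (a : A) (f : C₀(ℝ, A)) (t : ℝ) : (constMult a).snd f t = f t * a := rfl

end Compactification

end HilbertSuspension

end

open HilbertSuspension

/-!
Everything follows from a finite normalised frame of `E`: vectors `e₁, …, eₙ` with
`y = ∑ i, eᵢ · (eᵢ | y)` for all `y` (`exists_frame`). The matrix `q = ((eᵢ | eⱼ))ᵢⱼ` is then a
projection over `A`, and `y ↦ ((eᵢ | y))ᵢ` identifies `E` with `q Aⁿ`. The reconstruction formula
holds pointwise for functions with values in `E`, so the same map, with the `eᵢ` read as constant
functions, identifies `C₀(ℝ, E)` with `(1 ⊗ q) C₀(ℝ, A)ⁿ` (`hilbertIsoCorner_of_frame`) and the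
multiplier module with `(1 ⊗ q) Mult(C₀(ℝ, A))ⁿ` (`multModule_isoCorner_of_frame`). The constants
`eᵢ` are multipliers and `∑ i, Θ_{eᵢ, eᵢ} = 1`, so `T = ∑ i, Θ_{T eᵢ, eᵢ}` for every adjointable `T`:
the rank-one operators span `End(C₀(ℝ, E))` even without closure (`isFullLeft_of_frame`).

To find the frame, let `x` be a finite generating row of `E` and `G = ((xᵢ | xⱼ))ᵢⱼ` its Gram matrix,
a positive element of the C⋆-algebra `Mₙ(A)`. Since `M ↦ x · M` maps `Mₙ(A)` onto `Eⁿ`, the open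
mapping theorem solves `x · X = x · F` with a bound on `X` (`exists_bounded_solution`), and this makes
`0` an isolated point of the spectrum of `G` (`exists_spectrum_gap`). Hence `G ^ (-1/2)` exists off the
kernel of `G`, and `e = x · G ^ (-1/2)` is a normalised frame.

The functional calculus is applied to an element `G` of an abstract C⋆-algebra and only its
conclusions are transferred to `CStarMatrix`, for which instance search does not find the real
continuous functional calculus directly.
-/

noncomputable section

namespace HilbertSuspension

open MulOpposite

/-! ### Inverse square roots off an isolated zero -/

section FunctionalCalculus

variable {B : Type*} [CStarAlgebra B] {G : B}

theorem cfc_mul_self_mul_cfc (hG : IsSelfAdjoint G) {f g : ℝ → ℝ} (hf : Continuous f)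
    (hg : Continuous g) : cfc f G * G * cfc g G = cfc (fun s => f s * s * g s) G := by
  have hid : cfc (fun s : ℝ => s) G = G := cfc_id' ℝ G
  rw [cfc_mul (fun s => f s * s) g G, cfc_mul f (fun s => s) G, hid]

/-- If `-G` has no nonzero compression `N (-G) N` of the form `M⋆ M`, then `G` has no negative
spectrum: take for `N` the negative part `G⁻` of `G` and for `M` its power `(G⁻) ^ (3/2)`. -/
theorem spectrum_nonneg_of_compressions (hG : IsSelfAdjoint G)
    (h : ∀ N M : B, star N = N → N * G * N = -(star M * M) → M = 0) :
    ∀ r ∈ spectrum ℝ G, 0 ≤ r := by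
  intro r hr
  let k : ℝ → ℝ := fun s => max (-s) 0
  let m : ℝ → ℝ := fun s => k s * √(k s)
  have hk : Continuous k := by fun_prop
  have hm : Continuous m := by fun_prop
  have hk0 : ∀ s, 0 ≤ k s := fun s => le_max_right _ _
  have hM : cfc m G = 0 := by
    refine h (cfc k G) _ (cfc_predicate k G : IsSelfAdjoint _).star_eq ?_
    rw [(cfc_predicate m G : IsSelfAdjoint _).star_eq, cfc_mul_self_mul_cfc hG hk hk,
      ← cfc_mul m m G, ← cfc_neg]
    refine cfc_congr fun s _ => ?_
    have h1 : √(k s) * √(k s) = k s := Real.mul_self_sqrt (hk0 s)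
    have h2 : k s * s = -(k s * k s) := by
      rcases le_total 0 s with hs | hs
      · simp [k, hs]
      · simp [k, hs]
    calc k s * s * k s = -(k s * k s * (√(k s) * √(k s))) := by rw [h2, h1]; ring
      _ = -(m s * m s) := by simp only [m]; ring
  have h0 : ‖m r‖ ≤ 0 := by
    simpa [hM] using norm_apply_le_norm_cfc m G hr
  by_contra! hneg
  have hkr : 0 < k r := lt_max_of_lt_left (neg_pos.2 hneg)
  have : 0 < m r := mul_pos hkr (Real.sqrt_pos.2 hkr)
  exact absurd h0 (not_le.2 (norm_pos_iff.2 this.ne'))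

/-- If every equation `G X = G F` has a solution whose norm is controlled by the compression
`F⋆ G F`, then the positive spectrum of `G` is bounded away from `0`. For a positive spectral value
`r`, let `F = f(G)` with `f r = 1` and with `f` cut off above `r`; then
`F G F = F G X` bounds `r` from below. -/
theorem exists_spectrum_gap (hG : IsSelfAdjoint G) {C : ℝ} (hC : 0 < C)
    (h : ∀ F : B, ∃ X, G * X = G * F ∧ ‖X‖ ≤ C * √‖star F * G * F‖) :
    ∀ r ∈ spectrum ℝ G, 0 < r → (C ^ 2)⁻¹ ≤ r := by
  intro r hr hpos
  have hmax : ∀ s : ℝ, 0 < max r |s| := fun s => hpos.trans_le (le_max_left _ _)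
  obtain ⟨f, hf, hfr, hf0, hf1, hfs⟩ : ∃ f : ℝ → ℝ, Continuous f ∧ f r = 1 ∧ (∀ s, 0 ≤ f s) ∧
      (∀ s, f s ≤ 1) ∧ ∀ s, ‖f s * s‖ ≤ r := by
    have h0 : ∀ s : ℝ, 0 ≤ r / max r |s| := fun s => div_nonneg hpos.le (hmax s).le
    refine ⟨fun s => r / max r |s|, continuous_const.div (by fun_prop) fun s => (hmax s).ne',
      by simp [abs_of_pos hpos, hpos.ne'], h0,
      fun s => (div_le_one (hmax s)).2 (le_max_left _ _), fun s => ?_⟩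
    rw [norm_mul, Real.norm_of_nonneg (h0 s), Real.norm_eq_abs, div_mul_eq_mul_div,
      div_le_iff₀ (hmax s)]
    gcongr
    exact le_max_right _ _
  set F := cfc f G with hF
  have hFsa : star F = F := (cfc_predicate f G : IsSelfAdjoint F).star_eq
  have hFG : F * G = cfc (fun s => f s * s) G := by
    have hid : cfc (fun s : ℝ => s) G = G := cfc_id' ℝ G
    rw [cfc_mul f (fun s => s) G, hid]
  have hFGF : F * G * F = cfc (fun s => f s * s * f s) G := cfc_mul_self_mul_cfc hG hf hf
  have hn1 : ‖F * G‖ ≤ r := by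
    rw [hFG]
    exact norm_cfc_le hpos.le fun s _ => hfs s
  have hn2 : ‖F * G * F‖ ≤ r := by
    rw [hFGF]
    refine norm_cfc_le hpos.le fun s _ => ?_
    rw [norm_mul, Real.norm_of_nonneg (hf0 s)]
    exact (mul_le_of_le_one_right (norm_nonneg _) (hf1 s)).trans (hfs s)
  have hn3 : r ≤ ‖F * G * F‖ := by
    have := norm_apply_le_norm_cfc (fun s => f s * s * f s) G hr
    rw [hFGF]
    simpa [hfr, abs_of_pos hpos] using this
  obtain ⟨X, hX, hXn⟩ := h F
  rw [hFsa] at hXn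
  have hkey : r ≤ r * (C * √r) :=
    calc r ≤ ‖F * G * F‖ := hn3
      _ = ‖F * G * X‖ := by rw [mul_assoc, mul_assoc, hX]
      _ ≤ ‖F * G‖ * ‖X‖ := norm_mul_le _ _
      _ ≤ r * (C * √r) := by gcongr; exact hXn.trans (by gcongr)
  have h1 : 1 ≤ C * √r := le_of_mul_le_mul_left (by simpa using hkey) hpos
  rw [inv_le_iff_one_le_mul₀ (by positivity)]
  calc (1 : ℝ) ≤ (C * √r) ^ 2 := one_le_pow₀ h1
    _ = r * C ^ 2 := by rw [mul_pow, Real.sq_sqrt hpos.le, mul_comm]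

/-- An element whose spectrum is nonnegative with `0` isolated has an inverse square root off its
kernel. -/
theorem exists_inverse_sqrt (hG : IsSelfAdjoint G) {ε : ℝ} (hε : 0 < ε)
    (h : ∀ r ∈ spectrum ℝ G, r = 0 ∨ ε ≤ r) : ∃ H : B, star H = H ∧ G * (H * (H * G)) = G := by
  have hmax : ∀ s : ℝ, 0 < max s ε := fun s => hε.trans_le (le_max_right _ _)
  let k : ℝ → ℝ := fun s => (√(max s ε))⁻¹
  have hk : Continuous k :=
    Continuous.inv₀ (by fun_prop) fun s => (Real.sqrt_pos.2 (hmax s)).ne'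
  refine ⟨cfc k G, (cfc_predicate k G : IsSelfAdjoint _).star_eq, ?_⟩
  have hid : cfc (fun s : ℝ => s) G = G := cfc_id' ℝ G
  calc G * (cfc k G * (cfc k G * G)) = cfc (fun s => s * (k s * (k s * s))) G := by
        rw [cfc_mul (fun s => s) (fun s => k s * (k s * s)) G,
          cfc_mul k (fun s => k s * s) G, cfc_mul k (fun s => s) G, hid]
    _ = cfc (fun s : ℝ => s) G := by
        refine cfc_congr fun s hs => ?_
        rcases h s hs with rfl | hle
        · simp
        · have hs0 : 0 < s := hε.trans_le hle
          simp only [k, max_eq_left hle]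
          rw [← mul_assoc (√s)⁻¹, ← mul_inv, Real.mul_self_sqrt hs0.le, inv_mul_cancel₀ hs0.ne',
            mul_one]
    _ = G := hid

end FunctionalCalculus

/-! ### Rows of vectors and their Gram matrices -/

section Frame

variable {A : Type*} [CStarAlgebra A] {E : Type*} [NormedAddCommGroup E] [Module Aᵐᵒᵖ E] {n : ℕ}

/-- The row `x · M` for a row `x` of vectors and a square matrix `M`. -/
def rowMul (x : Fin n → E) (M : CStarMatrix (Fin n) (Fin n) A) : Fin n → E :=
  fun j => ∑ i, op (M i j) • x i

theorem rowMul_one (x : Fin n → E) :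
    rowMul x (1 : CStarMatrix (Fin n) (Fin n) A) = x := by
  funext j
  rw [rowMul, Finset.sum_eq_single j]
  · simp
  · intro i _ hij
    simp [CStarMatrix.one_apply_ne hij]
  · simp

theorem rowMul_mul (x : Fin n → E) (M N : CStarMatrix (Fin n) (Fin n) A) :
    rowMul (rowMul x M) N = rowMul x (M * N) := by
  funext k
  simp only [rowMul, CStarMatrix.mul_apply, Finset.smul_sum, Finset.op_sum, Finset.sum_smul, smul_smul,
    op_mul]
  exact Finset.sum_comm

theorem rowMul_sub (x : Fin n → E) (M N : CStarMatrix (Fin n) (Fin n) A) :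
    rowMul x (M - N) = rowMul x M - rowMul x N := by
  funext k
  simp [rowMul, sub_smul]

variable [PartialOrder A] [NormedSpace ℂ E] [CStarModule Aᵐᵒᵖ E]

/-- An element of a right Hilbert module is determined by its inner products. -/
theorem ext_rinner {B F : Type*} [NonUnitalCStarAlgebra B] [PartialOrder B]
    [NormedAddCommGroup F] [NormedSpace ℂ F] [SMul Bᵐᵒᵖ F] [CStarModule Bᵐᵒᵖ F] {y y' : F}
    (h : ∀ z, rinner B z y = rinner B z y') : y = y' := by
  have h' : inner Bᵐᵒᵖ (y - y') (y - y') = 0 := by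
    rw [CStarModule.inner_sub_right, sub_eq_zero]
    exact unop_injective (h (y - y'))
  exact sub_eq_zero.1 (CStarModule.inner_self.1 h')

theorem rinner_sum_right {ι : Type*} (s : Finset ι) (x : E) (y : ι → E) :
    rinner A x (∑ i ∈ s, y i) = ∑ i ∈ s, rinner A x (y i) := by
  simp [rinner, CStarModule.inner_sum_right]

/-- The matrix of the inner products `(xᵢ | yⱼ)` of two rows of vectors. -/
def gram (x y : Fin n → E) : CStarMatrix (Fin n) (Fin n) A :=
  CStarMatrix.ofMatrix fun i j => rinner A (x i) (y j)

theorem gram_apply (x y : Fin n → E) (i j : Fin n) :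
    gram (A := A) x y i j = rinner A (x i) (y j) := rfl

theorem star_gram (x y : Fin n → E) : star (gram (A := A) x y) = gram y x := by
  ext i j
  exact star_rinner A _ _

theorem gram_rowMul_right (x y : Fin n → E) (M : CStarMatrix (Fin n) (Fin n) A) :
    gram x (rowMul y M) = gram x y * M := by
  ext i j
  simp [gram_apply, rowMul, CStarMatrix.mul_apply, rinner_sum_right, rinner_op_smul_right]

theorem gram_rowMul_left (x y : Fin n → E) (M : CStarMatrix (Fin n) (Fin n) A) :
    gram (rowMul x M) y = star M * gram x y := by
  rw [← star_gram, gram_rowMul_right, star_mul, star_gram]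

theorem isSelfAdjoint_gram (x : Fin n → E) : IsSelfAdjoint (gram (A := A) x x) := star_gram x x

theorem gram_self_eq_zero {x : Fin n → E} (h : gram (A := A) x x = 0) : x = 0 := by
  funext i
  have h' : inner Aᵐᵒᵖ (x i) (x i) = 0 := unop_injective
    (congrArg (fun M : CStarMatrix (Fin n) (Fin n) A => M i i) h)
  exact CStarModule.inner_self.1 h'

theorem op_complex_smul (c : ℂ) (a : A) (x : E) : op (c • a) • x = c • op a • x := by
  refine ext_rinner (B := A) fun z => ?_
  rw [rinner_op_smul_right, rinner_smul_right, rinner_op_smul_right, mul_smul_comm]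

variable [StarOrderedRing A]

theorem norm_sq_le_norm_gram (x : Fin n → E) : ‖x‖ ^ 2 ≤ ‖gram (A := A) x x‖ := by
  have h : ‖x‖ ≤ √‖gram (A := A) x x‖ := by
    refine (pi_norm_le_iff_of_nonneg (Real.sqrt_nonneg _)).2 fun i => Real.le_sqrt_of_sq_le ?_
    rw [CStarModule.norm_sq_eq Aᵐᵒᵖ (x := x i)]
    exact CStarMatrix.norm_entry_le_norm (M := gram (A := A) x x) (i := i) (j := i)
  exact (Real.le_sqrt (norm_nonneg _) (norm_nonneg _)).1 h

/-- The Gram matrix `G` of `x` satisfies the criterion `spectrum_nonneg_of_compressions`: if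
`N G N = -M⋆ M`, then the diagonal entries of `N G N`, the Gram matrix of `x · N`, are both
nonnegative and nonpositive. -/
theorem eq_zero_of_gram_compression (x : Fin n → E) (N M : CStarMatrix (Fin n) (Fin n) A)
    (hN : star N = N) (h : N * gram x x * N = -(star M * M)) : M = 0 := by
  ext k i
  have hgram : gram (rowMul x N) (rowMul x N) = -(star M * M) := by
    rw [gram_rowMul_right, gram_rowMul_left, hN, h]
  have h1 : 0 ≤ rinner A (rowMul x N i) (rowMul x N i) :=
    CStarModule.inner_self_nonneg (A := Aᵐᵒᵖ) (x := rowMul x N i)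
  have h2 : rinner A (rowMul x N i) (rowMul x N i) = -∑ k, star (M k i) * M k i := by
    have := congrArg (fun P : CStarMatrix (Fin n) (Fin n) A => P i i) hgram
    simpa [CStarMatrix.mul_apply, gram_apply,
      CStarMatrix.star_apply] using this
  have hpos : ∀ k ∈ Finset.univ, 0 ≤ star (M k i) * M k i := fun k _ => star_mul_self_nonneg _
  have h3 : ∑ k, star (M k i) * M k i = 0 :=
    le_antisymm (by rwa [h2, neg_nonneg] at h1) (Finset.sum_nonneg hpos)
  exact CStarRing.star_mul_self_eq_zero_iff _ |>.1
    ((Finset.sum_eq_zero_iff_of_nonneg hpos).1 h3 k (Finset.mem_univ k))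

/-! ### Normalised frames of finitely generated modules -/

variable (A) in
/-- The map `M ↦ x · M` as a bounded operator on the matrix algebra. -/
def rowMulL (x : Fin n → E) : CStarMatrix (Fin n) (Fin n) A →L[ℂ] (Fin n → E) :=
  LinearMap.mkContinuous
    { toFun := rowMul x
      map_add' := fun M N => by
        funext j
        simp [rowMul, add_smul, Finset.sum_add_distrib]
      map_smul' := fun c M => by
        funext j
        simp [rowMul, op_complex_smul, Finset.smul_sum, -op_smul] } (∑ i, ‖x i‖) fun M => by
    refine (pi_norm_le_iff_of_nonneg (by positivity)).2 fun j => ?_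
    rw [Finset.sum_mul]
    change ‖∑ i, op (M i j) • x i‖ ≤ _
    refine norm_sum_le_of_le _ fun i _ => (norm_op_smul_le _ _).trans ?_
    gcongr
    exact CStarMatrix.norm_entry_le_norm (M := M) (i := i) (j := j)

theorem rowMulL_apply (x : Fin n → E) (M : CStarMatrix (Fin n) (Fin n) A) :
    rowMulL A x M = rowMul x M := rfl

theorem rowMulL_surjective {x : Fin n → E} (hx : Submodule.span Aᵐᵒᵖ (Set.range x) = ⊤) :
    Function.Surjective (rowMulL A x) := by
  intro y
  have h : ∀ j, ∃ c : Fin n → Aᵐᵒᵖ, ∑ i, c i • x i = y j := fun j =>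
    (Submodule.mem_span_range_iff_exists_fun _).1 (hx ▸ Submodule.mem_top)
  choose c hc using h
  exact ⟨CStarMatrix.ofMatrix fun i j => unop (c j i), funext hc⟩

/-- If `x` generates `E`, then the open mapping theorem bounds the norm of some solution `X` of
`x · X = x · F` by the norm of `x · F`, hence by the Gram matrix `F⋆ G F` of that row. -/
theorem exists_bounded_solution [CompleteSpace E] {x : Fin n → E}
    (hx : Submodule.span Aᵐᵒᵖ (Set.range x) = ⊤) :
    ∃ C > 0, ∀ F : CStarMatrix (Fin n) (Fin n) A, ∃ X : CStarMatrix (Fin n) (Fin n) A,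
      gram x x * X = gram x x * F ∧ ‖X‖ ≤ C * √‖star F * gram x x * F‖ := by
  obtain ⟨C, hC, hpre⟩ := (rowMulL A x).exists_preimage_norm_le (rowMulL_surjective hx)
  refine ⟨C, hC, fun F => ?_⟩
  obtain ⟨X, hX, hXn⟩ := hpre (rowMulL A x F)
  rw [rowMulL_apply, rowMulL_apply] at hX
  rw [rowMulL_apply] at hXn
  refine ⟨X, by rw [← gram_rowMul_right, hX, gram_rowMul_right], hXn.trans ?_⟩
  gcongr
  refine Real.le_sqrt_of_sq_le ((norm_sq_le_norm_gram (A := A) _).trans_eq ?_)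
  rw [gram_rowMul_right, gram_rowMul_left]

/-- The Gram matrix `G` of a generating row has an inverse square root off its kernel. -/
theorem exists_gram_inverse_sqrt [CompleteSpace E] {x : Fin n → E}
    (hx : Submodule.span Aᵐᵒᵖ (Set.range x) = ⊤) :
    ∃ H : CStarMatrix (Fin n) (Fin n) A,
      star H = H ∧ gram x x * (H * (H * gram x x)) = gram x x := by
  obtain ⟨C, hC, hsol⟩ := exists_bounded_solution (A := A) hx
  exact exists_inverse_sqrt (isSelfAdjoint_gram x) (ε := (C ^ 2)⁻¹) (by positivity) fun r hr =>
    (spectrum_nonneg_of_compressions (isSelfAdjoint_gram x) (eq_zero_of_gram_compression x)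
      r hr).eq_or_lt.imp Eq.symm (exists_spectrum_gap (isSelfAdjoint_gram x) hC hsol r hr)

variable (A E) in
/-- A finitely generated Hilbert module over a unital C⋆-algebra has a finite normalised frame:
vectors `eᵢ` with `y = ∑ i, eᵢ · (eᵢ | y)` for all `y`. For a generating row `x` with Gram matrix `G`
one takes `e = x · G ^ (-1/2)`, where the inverse square root is `0` on the kernel of `G`. -/
theorem exists_frame [CompleteSpace E] [Module.Finite Aᵐᵒᵖ E] :
    ∃ (n : ℕ) (e : Fin n → E), ∀ y, ∑ i, op (rinner A (e i) y) • e i = y := by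
  obtain ⟨n, x, hx⟩ := Module.Finite.exists_fin (R := Aᵐᵒᵖ) (M := E)
  obtain ⟨H, hHsa, hreg⟩ := exists_gram_inverse_sqrt (A := A) hx
  -- The Gram matrix of `x · (H H G - 1)` is `(H H G - 1)⋆ G (H H G - 1) = 0`.
  have hx' : rowMul (rowMul x H) (gram (A := A) (rowMul x H) x) = x := by
    rw [gram_rowMul_left, hHsa, rowMul_mul, ← sub_eq_zero]
    conv_lhs => arg 2; rw [← rowMul_one (A := A) x]
    rw [← rowMul_sub]
    refine gram_self_eq_zero (A := A) ?_
    rw [gram_rowMul_right, gram_rowMul_left, mul_assoc, mul_sub, hreg, mul_one, sub_self, mul_zero]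
  refine ⟨n, rowMul x H, fun y => ?_⟩
  have hy : y ∈ Submodule.span Aᵐᵒᵖ (Set.range x) := hx ▸ Submodule.mem_top
  induction hy using Submodule.span_induction with
  | mem y hy =>
    obtain ⟨j, rfl⟩ := hy
    exact congrFun hx' j
  | zero => simp [rinner]
  | add y z _ _ hy hz =>
    simp only [rinner_add_right, op_add, add_smul, Finset.sum_add_distrib, hy, hz]
  | smul a y _ hy =>
    induction a using MulOpposite.rec' with
    | _ a =>
    simp only [rinner_op_smul_right, op_mul, mul_smul, ← Finset.smul_sum, hy]

end Frame

/-! ### Adjoints and multipliers -/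

section Multiplier

variable {B : Type*} [NonUnitalCStarAlgebra B] [PartialOrder B]
variable {E F : Type*}
variable [NormedAddCommGroup E] [NormedSpace ℂ E] [SMul Bᵐᵒᵖ E] [CStarModule Bᵐᵒᵖ E]
variable [NormedAddCommGroup F] [NormedSpace ℂ F] [SMul Bᵐᵒᵖ F] [CStarModule Bᵐᵒᵖ F]

theorem Adjointable.adj_apply_eq (T : Adjointable B E F) {S : F → E}
    (h : ∀ x y, rinner B (T.1 x) y = rinner B x (S y)) (y : F) : (adj T).1 y = S y :=
  ext_rinner (B := B) fun z => by rw [← rinner_adj, h]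

/-- A double centralizer of a C⋆-algebra is determined by its left multiplication. -/
theorem doubleCentralizer_ext {B : Type*} [NonUnitalCStarAlgebra B] {d d' : 𝓜(ℂ, B)}
    (h : ∀ b, d.fst b = d'.fst b) : d = d' := by
  refine DoubleCentralizer.ext ℂ B d d' (Prod.ext (ContinuousLinearMap.ext h) ?_)
  refine ContinuousLinearMap.ext fun x => sub_eq_zero.1 ?_
  have hz : ∀ y, (d.snd x - d'.snd x) * y = 0 := fun y => by
    rw [sub_mul, d.central, d'.central, h, sub_self]
  exact (CStarRing.mul_star_self_eq_zero_iff _).1 (hz _)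

theorem doubleCentralizer_sum_fst_apply {B : Type*} [NonUnitalCStarAlgebra B] {ι : Type*}
    (s : Finset ι) (d : ι → 𝓜(ℂ, B)) (b : B) : (∑ i ∈ s, d i).fst b = ∑ i ∈ s, (d i).fst b :=
  map_sum (AddMonoidHom.mk' (fun d : 𝓜(ℂ, B) => d.fst b) fun _ _ => rfl) d s

variable [StarOrderedRing B]

theorem MultModule.inner_fst_apply (m m' : MultModule B E) (b : B) :
    (MultModule.inner m m').fst b = (Adjointable.adj m).1 (m'.1 b) := rfl

theorem MultModule.star_inner (m m' : MultModule B E) :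
    star (MultModule.inner m m') = MultModule.inner m' m := by
  refine doubleCentralizer_ext fun b => ?_
  rw [DoubleCentralizer.star_fst]
  change star (star ((Adjointable.adj m').1 (m.1 (star (star b))))) = _
  rw [star_star, star_star, MultModule.inner_fst_apply]

end Multiplier

/-! ### Constant multipliers of the suspension -/

section Suspension

theorem Suspension.sum_apply {ι : Type*} {E : Type*} [NormedAddCommGroup E]
    (s : Finset ι) (x : ι → Suspension E) (t : ℝ) :
    (∑ i ∈ s, x i) t = ∑ i ∈ s, x i t :=
  map_sum (AddMonoidHom.mk' (fun x : Suspension E => x t) fun _ _ => rfl) x s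

theorem zeroAtInfty_sum_apply {ι A : Type*} [CStarAlgebra A] (s : Finset ι) (f : ι → C₀(ℝ, A))
    (t : ℝ) :
    (∑ i ∈ s, f i) t = ∑ i ∈ s, f i t :=
  map_sum (AddMonoidHom.mk' (fun f : C₀(ℝ, A) => f t) fun _ _ => rfl) f s

variable {A : Type*} [CStarAlgebra A] [PartialOrder A] [StarOrderedRing A]
variable {E : Type*} [NormedAddCommGroup E] [NormedSpace ℂ E] [Module Aᵐᵒᵖ E] [CStarModule Aᵐᵒᵖ E]

variable (A) in
/-- The operator `x ↦ (t ↦ (e | x t))` from `C₀(ℝ, E)` to `C₀(ℝ, A)`. -/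
def constInner (e : E) : Suspension E →L[ℂ] C₀(ℝ, A) :=
  LinearMap.mkContinuous
    { toFun := fun x =>
        { toFun := fun t => rinner A e (x t)
          continuous_toFun := continuous_rinner.comp
            (continuous_const.prodMk (map_continuous (F := C₀(ℝ, E)) x))
          zero_at_infty' := by
            have hx := ZeroAtInftyContinuousMap.zero_at_infty' (α := ℝ) (β := E) x
            have h := ((continuous_rinner (A := A)).tendsto (e, (0 : E))).comp
              (tendsto_const_nhds.prodMk_nhds hx)
            have h0 : rinner A e (0 : E) = 0 := by simp [rinner]
            rwa [h0] at h }
      map_add' := fun x y => by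
        ext t
        exact rinner_add_right A _ _ _
      map_smul' := fun c x => by
        ext t
        exact rinner_smul_right A _ _ _ } ‖e‖ fun x => by
    refine (zeroAtInfty_norm_le _ (by positivity)).2 fun t => ?_
    have h : ‖rinner A e (x t)‖ ≤ ‖e‖ * ‖x t‖ := CStarModule.norm_inner_le (A := Aᵐᵒᵖ) E
    refine h.trans ?_
    gcongr
    exact (zeroAtInfty_norm_le (E := E) x (norm_nonneg _)).1 le_rfl t

theorem constInner_apply (e : E) (x : Suspension E) (t : ℝ) :
    constInner A e x t = rinner A e (x t) := rfl

/-- The constant function `e`, as a multiplier `f ↦ (t ↦ e · f t)` of `C₀(ℝ, E)`. -/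
def constMultModule (e : E) : MultModule C₀(ℝ, A) (Suspension E) :=
  ⟨LinearMap.mkContinuous
    { toFun := fun f =>
        ({ toFun := fun t => op (f t) • e
           continuous_toFun := continuous_op_smul.comp
             ((continuous_op.comp (map_continuous f)).prodMk continuous_const)
           zero_at_infty' := by
             have h := (continuous_op_smul.tendsto (op (0 : A), e)).comp
               (((continuous_op.tendsto _).comp f.zero_at_infty').prodMk_nhds tendsto_const_nhds)
             rwa [op_zero, zero_smul] at h } : C₀(ℝ, E))
      map_add' := fun f g => Suspension.ext fun t => add_smul (op (f t)) (op (g t)) e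
      map_smul' := fun c f => Suspension.ext fun t => op_complex_smul c (f t) e } ‖e‖ fun f => by
    refine (zeroAtInfty_norm_le (E := E) _ (by positivity)).2 fun t => ?_
    refine (norm_op_smul_le (op (f t)) e).trans ?_
    gcongr
    exact (zeroAtInfty_norm_le f (norm_nonneg _)).1 le_rfl t,
  constInner A e, fun f x => by
    ext t
    change rinner A (op (f t) • e) (x t) = star (f t) * rinner A e (x t)
    rw [← star_rinner, rinner_op_smul_right, star_mul, star_rinner]⟩

theorem constMultModule_apply (e : E) (f : C₀(ℝ, A)) (t : ℝ) :
    (constMultModule e).1 f t = op (f t) • e := rfl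

theorem adj_constMultModule_apply (e : E) (x : Suspension E) :
    (Adjointable.adj (constMultModule (A := A) e)).1 x = constInner A e x := by
  refine Adjointable.adj_apply_eq _ (fun f x => ?_) x
  ext t
  change rinner A (op (f t) • e) (x t) = star (f t) * rinner A e (x t)
  rw [← star_rinner, rinner_op_smul_right, star_mul, star_rinner]

end Suspension

/-! ### Suspensions of modules with a normalised frame -/

section Frame

variable {A : Type*} [CStarAlgebra A] [PartialOrder A]
variable {E : Type*} [NormedAddCommGroup E] [NormedSpace ℂ E] [Module Aᵐᵒᵖ E] [CStarModule Aᵐᵒᵖ E]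
variable {n : ℕ} {e : Fin n → E}

variable (A) in
/-- The projection `((eᵢ | eⱼ))ᵢⱼ` of a normalised frame `e`. -/
def frameProjection (e : Fin n → E) : Matrix (Fin n) (Fin n) A :=
  Matrix.of fun i j => rinner A (e i) (e j)

/-- `(z | y) = ∑ i, (z | eᵢ) (eᵢ | y)` for a normalised frame `e`. -/
theorem sum_rinner_mul_rinner (he : ∀ y, ∑ i, op (rinner A (e i) y) • e i = y) (z y : E) :
    ∑ i, rinner A z (e i) * rinner A (e i) y = rinner A z y := by
  conv_rhs => rw [← he y, rinner_sum_right]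
  simp only [rinner_op_smul_right]

theorem isStarProjection_frameProjection (he : ∀ y, ∑ i, op (rinner A (e i) y) • e i = y) :
    IsStarProjection (frameProjection A e) := by
  refine ⟨?_, ?_⟩
  · ext i k
    rw [Matrix.mul_apply]
    exact sum_rinner_mul_rinner he _ _
  · ext i j
    exact star_rinner A _ _

variable [StarOrderedRing A]

theorem sum_constMultModule_constInner (he : ∀ y, ∑ i, op (rinner A (e i) y) • e i = y)
    (x : Suspension E) : ∑ i, (constMultModule (e i)).1 (constInner A (e i) x) = x :=
  Suspension.ext fun t => by
    rw [Suspension.sum_apply]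
    exact he (x t)

/-- The identity operator of `C₀(ℝ, E)` is `∑ i, Θ_{eᵢ, eᵢ}` for the constant multipliers `eᵢ`, so
`T = ∑ i, Θ_{T eᵢ, eᵢ}` for every adjointable `T`. -/
theorem isFullLeft_of_frame (he : ∀ y, ∑ i, op (rinner A (e i) y) • e i = y) :
    MultModule.IsFullLeft C₀(ℝ, A) (Suspension E) := by
  refine eq_top_iff.2 fun T _ => Submodule.le_topologicalClosure _ ?_
  have hT : T = ∑ i, MultModule.theta (Adjointable.comp T (constMultModule (e i)))
      (constMultModule (e i)) := by
    refine Subtype.ext (ContinuousLinearMap.ext fun x => ?_)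
    rw [Submodule.coe_sum, sum_apply]
    conv_lhs => rw [← sum_constMultModule_constInner he x, map_sum]
    refine Finset.sum_congr rfl fun i _ => ?_
    rw [← adj_constMultModule_apply]
    rfl
  rw [hT]
  exact Submodule.sum_mem _ fun i _ => Submodule.subset_span ⟨(_, _), rfl⟩

/-- `x ↦ ((eᵢ | x))ᵢ` is an isomorphism of `C₀(ℝ, E)` onto `q C₀(ℝ, A)ⁿ`, where the projection
`q = ((eᵢ | eⱼ))ᵢⱼ` acts through an embedding `c` of `A` as constants in a unitisation. -/
theorem hilbertIsoCorner_of_frame (he : ∀ y, ∑ i, op (rinner A (e i) y) • e i = y)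
    {C : Type*} [CStarAlgebra C] (u : Unitisation C₀(ℝ, A) C) (c : A → C)
    (hc : ∀ (a : A) (f : C₀(ℝ, A)), c a * u.hom f = u.hom (a • f)) :
    HilbertIsoCorner u (Suspension E) ((frameProjection A e).map c) := by
  refine ⟨LinearMap.pi fun i => (constInner A (e i)).toLinearMap, fun x y hxy => ?_,
    fun x f i => ?_, fun x y => ?_, fun v => ?_⟩
  · rw [← sum_constMultModule_constInner he x, ← sum_constMultModule_constInner he y]
    exact Finset.sum_congr rfl fun i _ => congrArg _ (congrFun hxy i)
  · ext t
    exact rinner_op_smul_right A _ _ _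
  · ext t
    rw [zeroAtInfty_sum_apply, Suspension.rinner_apply, ← sum_rinner_mul_rinner he]
    refine Finset.sum_congr rfl fun i _ => ?_
    rw [← star_rinner]
    rfl
  · have hrange : (∀ i, ∑ j, (frameProjection A e).map c i j * u.hom (v j) = u.hom (v i)) ↔
        ∀ i, ∑ j, rinner A (e i) (e j) • v j = v i := forall_congr' fun i => by
      simp only [Matrix.map_apply, hc, ← map_sum]
      exact u.injective.eq_iff
    rw [hrange]
    constructor
    · rintro ⟨x, rfl⟩ i
      ext t
      rw [zeroAtInfty_sum_apply]
      exact sum_rinner_mul_rinner he _ _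
    · intro h
      refine ⟨∑ j, (constMultModule (e j)).1 (v j), funext fun i => ?_⟩
      ext t
      rw [← h i, zeroAtInfty_sum_apply]
      change rinner A (e i) ((∑ j, (constMultModule (e j)).1 (v j) : Suspension E) t) = _
      rw [Suspension.sum_apply, rinner_sum_right]
      exact Finset.sum_congr rfl fun j _ => rinner_op_smul_right A _ _ _

/-- `m ↦ ((eᵢ | m))ᵢ` is an isomorphism of the multiplier module of `C₀(ℝ, E)` onto the corner
`q Mult(C₀(ℝ, A))ⁿ` for the projection `q = ((eᵢ | eⱼ))ᵢⱼ`. -/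
theorem multModule_isoCorner_of_frame (he : ∀ y, ∑ i, op (rinner A (e i) y) • e i = y) :
    IsoCorner (M := MultModule C₀(ℝ, A) (Suspension E))
      MultModule.act MultModule.inner id ((frameProjection A e).map constMult) := by
  have hU : ∀ (a : E) (m : MultModule C₀(ℝ, A) (Suspension E)) (b : C₀(ℝ, A)),
      (MultModule.inner (constMultModule a) m).fst b = constInner A a (m.1 b) := fun a m b => by
    rw [MultModule.inner_fst_apply, adj_constMultModule_apply]
  refine ⟨LinearMap.pi fun i =>
    { toFun := fun m => MultModule.inner (constMultModule (e i)) m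
      map_add' := fun m m' => doubleCentralizer_ext fun b =>
        map_add (Adjointable.adj (constMultModule (A := A) (e i))).1 (m.1 b) (m'.1 b)
      map_smul' := fun c m => doubleCentralizer_ext fun b =>
        map_smul (Adjointable.adj (constMultModule (A := A) (e i))).1 c (m.1 b) },
    fun m m' hmm => ?_, fun m d i => doubleCentralizer_ext fun b => rfl, fun m m' => ?_, fun v => ?_⟩
  · refine Subtype.ext (ContinuousLinearMap.ext fun b => ?_)
    rw [← sum_constMultModule_constInner he (m.1 b), ← sum_constMultModule_constInner he (m'.1 b)]
    refine Finset.sum_congr rfl fun i _ => congrArg _ ?_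
    rw [← hU, ← hU]
    exact congrArg (fun d : 𝓜(ℂ, C₀(ℝ, A)) => d.fst b) (congrFun hmm i)
  · refine doubleCentralizer_ext fun b => ?_
    rw [doubleCentralizer_sum_fst_apply, MultModule.inner_fst_apply]
    conv_lhs => rw [← sum_constMultModule_constInner he (m'.1 b), map_sum]
    refine Finset.sum_congr rfl fun i _ => ?_
    change _ = (star (MultModule.inner (constMultModule (e i)) m)).fst
      ((MultModule.inner (constMultModule (e i)) m').fst b)
    rw [MultModule.star_inner, hU, MultModule.inner_fst_apply]
  · constructor
    · rintro ⟨m, rfl⟩ i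
      refine doubleCentralizer_ext fun b => ?_
      rw [doubleCentralizer_sum_fst_apply]
      ext t
      rw [zeroAtInfty_sum_apply]
      change _ = (MultModule.inner (constMultModule (e i)) m).fst b t
      rw [hU, constInner_apply, ← sum_rinner_mul_rinner he]
      refine Finset.sum_congr rfl fun j _ => ?_
      change rinner A (e i) (e j) * (MultModule.inner (constMultModule (e j)) m).fst b t = _
      rw [hU, constInner_apply]
    · intro h
      refine ⟨∑ j, MultModule.act (constMultModule (e j)) (v j), funext fun i => ?_⟩
      refine (doubleCentralizer_ext fun b => ?_ : _ = id (v i))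
      rw [← h i, doubleCentralizer_sum_fst_apply]
      ext t
      rw [zeroAtInfty_sum_apply]
      change (MultModule.inner (constMultModule (e i)) _).fst b t = _
      rw [hU, constInner_apply, Submodule.coe_sum, sum_apply,
        Suspension.sum_apply, rinner_sum_right]
      exact Finset.sum_congr rfl fun j _ => rinner_op_smul_right A _ _ _

end Frame

/-! ### Constants in compactifications -/

theorem const_mul_compactificationUnitisation {A : Type*} [CStarAlgebra A] {K : Type*}
    [TopologicalSpace K] [CompactSpace K] (j : C(ℝ, K)) (hj : DenseRange j) (π : C(K, OnePoint ℝ))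
    (hπ : ∀ t : ℝ, π (j t) = (t : OnePoint ℝ)) (a : A) (f : C₀(ℝ, A)) :
    ContinuousMap.const K a * (compactificationUnitisation A j hj π hπ).hom f =
      (compactificationUnitisation A j hj π hπ).hom (a • f) := by
  ext k
  change a * extendOnePoint f (π k) = extendOnePoint (a • f) (π k)
  induction π k using OnePoint.rec with
  | infty => exact mul_zero a
  | coe t => rfl

end HilbertSuspension

end

theorem corollary3p5 {A E : Type*} [CStarAlgebra A] [PartialOrder A] [StarOrderedRing A]
    [NormedAddCommGroup E] [NormedSpace ℂ E] [CompleteSpace E]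
    [Module Aᵐᵒᵖ E] [CStarModule Aᵐᵒᵖ E] [Module.Finite Aᵐᵒᵖ E] :
    MultModule.IsFullLeft C₀(ℝ, A) (Suspension E) ∧
    IsFiniteProjective (betaUnitisation A) (Suspension E) ∧
    ∃ (n : ℕ) (q : Matrix (Fin n) (Fin n) A), IsStarProjection q ∧
      HilbertIsoCorner (betaUnitisation A) (Suspension E) (q.map (ContinuousMap.const _)) ∧
      HilbertIsoCorner (onePointUnitisation A) (Suspension E) (q.map (ContinuousMap.const _)) ∧
      IsoCorner (M := MultModule C₀(ℝ, A) (Suspension E))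
        MultModule.act MultModule.inner id (q.map constMult) := by
  obtain ⟨n, e, he⟩ := exists_frame A E
  have hq := isStarProjection_frameProjection he
  have hβ : HilbertIsoCorner (betaUnitisation A) (Suspension E)
      ((frameProjection A e).map (ContinuousMap.const _)) :=
    hilbertIsoCorner_of_frame he _ _ (const_mul_compactificationUnitisation _ _ _ _)
  have hqβ : IsStarProjection
      ((frameProjection A e).map (ContinuousMap.const (StoneCech ℝ))) := by
    refine ⟨?_, ?_⟩
    · ext i k t
      have h := congrFun (congrFun hq.isIdempotentElem i) k
      rw [Matrix.mul_apply] at h ⊢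
      simpa [ContinuousMap.sum_apply] using h
    · ext i j t
      exact congrFun (congrFun hq.isSelfAdjoint i) j
  exact ⟨isFullLeft_of_frame he, ⟨n, _, hqβ, hβ⟩, n, frameProjection A e, hq, hβ,
    hilbertIsoCorner_of_frame he _ _ (const_mul_compactificationUnitisation _ _ _ _),
    multModule_isoCorner_of_frame he⟩
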